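/- Let $\mathcal B'$ be the class of power series $f(x)=1+\sum_{i=1}^\infty a_i x^i$ with all coefficients $a_i\in\{0,1,-1,2,-2\}$, and let $$\Omega_2'=\{x\in(0,1):\ \exists f\in\mathcal B',\ f(x)=f'(x)=0\}$$ be the set of double zeros in $(0,1)$ of elements of $\mathcal B'$. Then $1/2$ belongs to $\Omega_2'$ and is an isolated point of $\Omega_2'$; more precisely, the set $\Omega_2'\setminus\{1/2\}$ has a smallest element, and $$\min\bigl(\Omega_2'\setminus\{1/2\}\bigr)\in(0.5436,\,0.5438).$$ -/

import Mathlib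

open Set Filter Topology

/-- The coefficient sequences of the power series `1 + ∑_{i ≥ 1} a_i x^i` with every `a_i` in
`{0, ±1, ±2}`. -/
def coeffSeqs : Set (ℕ → ℤ) :=
  {a | a 0 = 1 ∧ ∀ i, 1 ≤ i → a i ∈ ({0, -1, 1, -2, 2} : Set ℤ)}

/-- The sum `x ↦ ∑ a_i x^i` of the power series with coefficients `a`. For bounded `a` the series
converges on `(-1, 1)`, and only its values there are used. -/
noncomputable def seriesFun (a : ℕ → ℤ) (x : ℝ) : ℝ :=
  ∑' i : ℕ, (a i : ℝ) * x ^ i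

/-- The set of double zeros in `(0, 1)`, that is, the points `x` with `f x = f' x = 0` for some
power series `f = 1 + ∑_{i ≥ 1} a_i x^i` with coefficients in `{0, ±1, ±2}`. -/
def doubleZeroSet : Set ℝ :=
  {x | x ∈ Ioo (0 : ℝ) 1 ∧
    ∃ a ∈ coeffSeqs, seriesFun a x = 0 ∧ HasDerivAt (seriesFun a) 0 x}

/-! The points 1/2 and the root τ ≈ 0.5437 of m = 1 - x - x² - x³ are double zeros of (1 - 2x)²(1 +
x)/(1 - x) and m²/(1 - x³), whose coefficients are admissible. Everything else rests on excluding x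
< 1/2 and 1/2 < x ≤ 0.5436; compactness then provides the minimum.

At a double zero, x f' - c f = ∑ (i - c) a_i x^i vanishes for every c. Bounding the tail by |a_i| ≤
2 gives, for each prefix of coefficients, a polynomial inequality in x
(`IsDoubleRoot.weighted_prefix_nonneg`). It excludes x < 1/2 outright, and on (1/2, 0.5436] it
forces a_1 = -2 and a_2 ∈ {-1, -2}. If a_2 = -1, the coefficients of m²/(1 - x³) are forced up to
index 11, and no choice of a_12 survives.

If a_2 = -2, subtract f from the extremal series 1 - 2x - 2x² + 2x³ + ⋯. The difference has
coefficients in [0, 4], the first nonzero one at some N. Its value F at x is of order (2x - 1)², and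
its logarithmic derivative x F'/F is at least 2/(2x - 1), but below N + 3 (`index_sum_lt`). So N is
large compared with 1/(2x - 1), while F = O(x^N) makes F too small. -/

/-! ### Convergence and term-by-term differentiation -/

theorem abs_coeff_le {a : ℕ → ℤ} (ha : a ∈ coeffSeqs) (i : ℕ) : |(a i : ℝ)| ≤ 2 := by
  have h : |a i| ≤ 2 := by
    rcases Nat.eq_zero_or_pos i with rfl | hi
    · rw [ha.1]; norm_num
    · have := ha.2 i hi
      simp only [mem_insert_iff, mem_singleton_iff] at this
      rcases this with h | h | h | h | h <;> rw [h] <;> norm_num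
  exact_mod_cast h

theorem hasSum_index_mul_pow {x : ℝ} (hx : |x| < 1) :
    HasSum (fun i : ℕ => (i : ℝ) * x ^ i) (x / (1 - x) ^ 2) :=
  hasSum_coe_mul_geometric_of_norm_lt_one (by simpa using hx)

/-- Index-weighted geometric tails are explicit. -/
theorem hasSum_affine_mul_pow {x : ℝ} (hx : |x| < 1) (n : ℕ) (c : ℝ) :
    HasSum (fun i : ℕ => 2 * (((i + n : ℕ) : ℝ) - c) * x ^ (i + n))
      (2 * x ^ n * ((n - c) / (1 - x) + x / (1 - x) ^ 2)) := by
  have h := (((hasSum_geometric_of_abs_lt_one hx).mul_left ((n : ℝ) - c)).add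
    (hasSum_index_mul_pow hx)).mul_left (2 * x ^ n)
  rw [div_eq_mul_inv ((n : ℝ) - c)]
  exact h.congr_fun fun i => by push_cast; ring

theorem summable_index_mul_coeff {a : ℕ → ℤ} (ha : a ∈ coeffSeqs) {x : ℝ} (hx : |x| < 1) :
    Summable fun i : ℕ => (i : ℝ) * a i * x ^ i := by
  have h := (hasSum_index_mul_pow (x := |x|) (by simpa using hx)).summable.mul_left 2
  refine Summable.of_norm_bounded h fun i => ?_
  rw [Real.norm_eq_abs, abs_mul, abs_mul, abs_pow, Nat.abs_cast]
  have := abs_coeff_le ha i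
  have h2 : (0 : ℝ) ≤ i * |x| ^ i := by positivity
  nlinarith

theorem summable_coeff {a : ℕ → ℤ} (ha : a ∈ coeffSeqs) {x : ℝ} (hx : |x| < 1) :
    Summable fun i : ℕ => (a i : ℝ) * x ^ i := by
  have h := (hasSum_geometric_of_abs_lt_one (r := |x|) (by simpa using hx)).summable.mul_left 2
  refine Summable.of_norm_bounded h fun i => ?_
  rw [Real.norm_eq_abs, abs_mul, abs_pow]
  exact mul_le_mul_of_nonneg_right (abs_coeff_le ha i) (by positivity)

/-- Term-by-term differentiation of the series. -/
theorem hasDerivAt_seriesFun {a : ℕ → ℤ} (ha : a ∈ coeffSeqs) {x : ℝ} (hx : |x| < 1) :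
    HasDerivAt (seriesFun a) (∑' i : ℕ, (a i : ℝ) * (i * x ^ (i - 1))) x := by
  obtain ⟨r, hxr, hr⟩ := exists_between hx
  have hr0 : 0 < r := (abs_nonneg x).trans_lt hxr
  have hu : Summable fun i : ℕ => 2 * (i * r ^ (i - 1)) := by
    have h := (hasSum_index_mul_pow (x := r) (by rwa [abs_of_pos hr0])).summable.mul_left (2 / r)
    refine h.congr fun i => ?_
    rcases i with _ | i
    · simp
    · have : r ^ (i + 1) = r * r ^ i := pow_succ' r i
      field_simp
      simp [this]
  refine hasDerivAt_tsum_of_isPreconnected (g := fun i y => (a i : ℝ) * y ^ i)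
    (g' := fun i y => (a i : ℝ) * (i * y ^ (i - 1))) (t := Metric.ball 0 r) (y₀ := 0) hu
    Metric.isOpen_ball (convex_ball 0 r).isPreconnected
    (fun i y _ => (hasDerivAt_pow i y).const_mul _) (fun i y hy => ?_)
    (Metric.mem_ball_self hr0) (summable_coeff ha (by simp)) (by simpa using hxr)
  have hy' : |y| ≤ r := by simpa using (Metric.mem_ball.1 hy).le
  rw [Real.norm_eq_abs, abs_mul, abs_mul, abs_pow, Nat.abs_cast]
  gcongr
  exact abs_coeff_le ha i

theorem mul_tsum_deriv {a : ℕ → ℤ} (x : ℝ) :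
    x * ∑' i : ℕ, (a i : ℝ) * (i * x ^ (i - 1)) = ∑' i : ℕ, (i : ℝ) * a i * x ^ i := by
  rw [← tsum_mul_left]
  congr 1
  ext i
  rcases i with _ | i
  · simp
  · simp [pow_succ]; ring

/-- `f` vanishes to second order at `x`, expressed through the values of `f` and `x f'`. -/
def IsDoubleRoot (a : ℕ → ℤ) (x : ℝ) : Prop :=
  HasSum (fun i : ℕ => (a i : ℝ) * x ^ i) 0 ∧ HasSum (fun i : ℕ => (i : ℝ) * a i * x ^ i) 0

/-- Since x ≠ 0, f' may be replaced by x f', which carries the same powers of x as f and so combines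
linearly with it. -/
theorem mem_doubleZeroSet_iff {x : ℝ} (hx : x ∈ Ioo (0 : ℝ) 1) :
    x ∈ doubleZeroSet ↔ ∃ a ∈ coeffSeqs, IsDoubleRoot a x := by
  have hx1 : |x| < 1 := by rw [abs_of_pos hx.1]; exact hx.2
  have key : ∀ a ∈ coeffSeqs, (seriesFun a x = 0 ∧ HasDerivAt (seriesFun a) 0 x) ↔
      IsDoubleRoot a x := by
    intro a ha
    have hd := hasDerivAt_seriesFun ha hx1
    have hm := mul_tsum_deriv (a := a) x
    constructor
    · rintro ⟨h0, h1⟩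
      rw [h1.unique hd |>.symm, mul_zero] at hm
      exact ⟨(summable_coeff ha hx1).hasSum_iff.2 h0,
        (summable_index_mul_coeff ha hx1).hasSum_iff.2 hm.symm⟩
    · rintro ⟨h0, h1⟩
      rw [h1.tsum_eq, mul_eq_zero, or_iff_right hx.1.ne'] at hm
      rw [hm] at hd
      exact ⟨h0.tsum_eq, hd⟩
  constructor
  · rintro ⟨-, a, ha, h⟩
    exact ⟨a, ha, (key a ha).1 h⟩
  · rintro ⟨a, ha, h⟩
    exact ⟨hx, a, ha, (key a ha).2 h⟩

/-! ### Inequalities for prefixes -/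

theorem IsDoubleRoot.hasSum_sub {a : ℕ → ℤ} {x : ℝ} (h : IsDoubleRoot a x) (c : ℝ) :
    HasSum (fun i : ℕ => ((i : ℝ) - c) * a i * x ^ i) 0 := by
  have := h.2.sub (h.1.mul_left c)
  simp only [mul_zero, sub_zero] at this
  exact this.congr_fun fun i => by ring

/-- If a prefix is too negative, the tail cannot compensate in `x f' - c f`. -/
theorem IsDoubleRoot.weighted_prefix_nonneg {a : ℕ → ℤ} {x : ℝ} (ha : a ∈ coeffSeqs)
    (hx : x ∈ Ioo (0 : ℝ) 1) (h : IsDoubleRoot a x) (n : ℕ) {c : ℝ} (hc : c ≤ n) :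
    0 ≤ (1 - x) ^ 2 * ∑ i ∈ Finset.range n, ((i : ℝ) - c) * a i * x ^ i
      + 2 * x ^ n * ((n - c) * (1 - x) + x) := by
  have hx1 : |x| < 1 := by rw [abs_of_pos hx.1]; exact hx.2
  have h1 := (hasSum_nat_add_iff' n).2 (h.hasSum_sub c)
  have h2 := hasSum_le (fun i => ?_) h1 (hasSum_affine_mul_pow hx1 n c)
  · have h3 : 0 < 1 - x := sub_pos.2 hx.2
    have h4 : (1 - x) ^ 2 * (2 * x ^ n * ((n - c) / (1 - x) + x / (1 - x) ^ 2))
        = 2 * x ^ n * ((n - c) * (1 - x) + x) := by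
      field_simp
    rw [← h4]
    nlinarith [sq_nonneg (1 - x)]
  · have hp : 0 < x ^ (i + n) := pow_pos hx.1 _
    have hi : (0 : ℝ) ≤ ((i + n : ℕ) : ℝ) - c := by
      push_cast
      linarith [(i.cast_nonneg : (0 : ℝ) ≤ i)]
    have := (abs_le.1 (abs_coeff_le ha (i + n))).2
    have h5 := mul_nonneg hi hp.le
    nlinarith

/-- If a prefix is too negative, the tail cannot compensate in `f`. -/
theorem IsDoubleRoot.prefix_nonneg {a : ℕ → ℤ} {x : ℝ} (ha : a ∈ coeffSeqs)
    (hx : x ∈ Ioo (0 : ℝ) 1) (h : IsDoubleRoot a x) (n : ℕ) :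
    0 ≤ (1 - x) * ∑ i ∈ Finset.range n, (a i : ℝ) * x ^ i + 2 * x ^ n := by
  have hx1 : |x| < 1 := by rw [abs_of_pos hx.1]; exact hx.2
  have h1 := (hasSum_nat_add_iff' n).2 h.1
  have h2 := hasSum_le (fun i => ?_) h1 ((hasSum_geometric_of_abs_lt_one hx1).mul_left (2 * x ^ n))
  · have h3 : 0 < 1 - x := sub_pos.2 hx.2
    have h4 : (1 - x) * (2 * x ^ n * (1 - x)⁻¹) = 2 * x ^ n := by
      field_simp
    rw [← h4]
    nlinarith
  · have hp : 0 < x ^ (i + n) := pow_pos hx.1 _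
    have := (abs_le.1 (abs_coeff_le ha (i + n))).2
    rw [show 2 * x ^ n * x ^ i = 2 * x ^ (i + n) by ring]
    exact mul_le_mul_of_nonneg_right this hp.le

/-- Multiplying `hd` by the weight n - c treats both directions at once: c < n uses an upper bound
on a_n, c > n a lower bound. The tail starts at n + 1, so c may be as large as n + 1. -/
theorem IsDoubleRoot.weighted_prefix_nonneg_of_coeff_le {a : ℕ → ℤ} {x : ℝ} (ha : a ∈ coeffSeqs)
    (hx : x ∈ Ioo (0 : ℝ) 1) (h : IsDoubleRoot a x) (n : ℕ) {c : ℝ} (hc : c ≤ n + 1) {d : ℝ}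
    (hd : (n - c) * a n ≤ (n - c) * d) :
    0 ≤ (1 - x) ^ 2 * (∑ i ∈ Finset.range n, ((i : ℝ) - c) * a i * x ^ i + (n - c) * d * x ^ n)
      + 2 * x ^ (n + 1) * ((n + 1 - c) * (1 - x) + x) := by
  have h1 := h.weighted_prefix_nonneg ha hx (n + 1) (c := c) (by exact_mod_cast hc)
  rw [Finset.sum_range_succ] at h1
  have h2 := mul_le_mul_of_nonneg_right hd (pow_nonneg hx.1.le n)
  have h3 := mul_le_mul_of_nonneg_left h2 (sq_nonneg (1 - x))
  push_cast at h1
  linarith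

theorem sub_pow_nonneg {x u : ℝ} (hu : x ≤ u) (k : ℕ) : 0 ≤ (u - x) ^ k :=
  pow_nonneg (sub_nonneg.2 hu) k

/-- With t = u - x, the relations 0 ≤ t^k and t^(k+1) ≤ (u - l) t^k are what lets `linarith` certify
the sign of a polynomial on [l, u], the powers of x being treated as atoms. -/
theorem sub_pow_succ_le {l x u : ℝ} (hl : l ≤ x) (hu : x ≤ u) (k : ℕ) :
    (u - x) ^ (k + 1) ≤ (u - l) * (u - x) ^ k := by
  rw [pow_succ']
  exact mul_le_mul_of_nonneg_right (by linarith) (sub_pow_nonneg hu k)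

theorem IsDoubleRoot.prefix_nonneg_of_coeff_le {a : ℕ → ℤ} {x : ℝ} (ha : a ∈ coeffSeqs)
    (hx : x ∈ Ioo (0 : ℝ) 1) (h : IsDoubleRoot a x) (n : ℕ) {d : ℝ} (hd : (a n : ℝ) ≤ d) :
    0 ≤ (1 - x) * (∑ i ∈ Finset.range n, (a i : ℝ) * x ^ i + d * x ^ n) + 2 * x ^ (n + 1) := by
  have h1 := h.prefix_nonneg ha hx (n + 1)
  rw [Finset.sum_range_succ] at h1
  have h2 := mul_le_mul_of_nonneg_right hd (pow_nonneg hx.1.le n)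
  have h3 := mul_le_mul_of_nonneg_left h2 (sub_nonneg.2 hx.2.le)
  linarith

theorem coeff_le_two {a : ℕ → ℤ} (ha : a ∈ coeffSeqs) (i : ℕ) : a i ≤ 2 := by
  exact_mod_cast (abs_le.1 (abs_coeff_le ha i)).2

theorem neg_two_le_coeff {a : ℕ → ℤ} (ha : a ∈ coeffSeqs) (i : ℕ) : -2 ≤ a i := by
  exact_mod_cast (abs_le.1 (abs_coeff_le ha i)).1

/-! ### Forced coefficients on (1/2, 0.5436] -/

/-! A double root in `(1/2, 0.5436]` with `a 2 = -1` would have to follow the coefficients of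
`(1 - x - x² - x³)² / (1 - x³)` up to index `11`, and then fail at index `12`. -/

theorem IsDoubleRoot.coeff_one_eq {a : ℕ → ℤ} {x : ℝ} (ha : a ∈ coeffSeqs)
    (hx : x ∈ Ioo (0 : ℝ) 1) (h : IsDoubleRoot a x) (hl : 1 / 2 < x) (hu : x ≤ 0.5436) :
    a 1 = -2 := by
  have h0 : a 0 = 1 := ha.1
  have hp := sub_pow_nonneg hu
  have hq := sub_pow_succ_le hl.le hu
  by_contra hne
  have hc : -1 ≤ a 1 := by have := neg_two_le_coeff ha 1; omega
  have hv : (a 1 : ℝ) ≥ -1 := by exact_mod_cast hc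
  have hv2 := (abs_le.1 (abs_coeff_le ha 2)).1
  have hx1 := mul_nonneg (sq_nonneg (1 - x)) (mul_nonneg hx.1.le
    (by linarith : (0 : ℝ) ≤ a 1 + 1))
  have hx2 := mul_nonneg (sq_nonneg (1 - x)) (mul_nonneg (sq_nonneg x)
    (by linarith : (0 : ℝ) ≤ a 2 + 2))
  have key := h.weighted_prefix_nonneg ha hx 3 (c := 3) (by norm_num)
  norm_num [Finset.sum_range_succ, h0] at key
  linarith [hp 0, hq 0, hp 1, hq 1, hp 2, hq 2, hp 3, hq 3, hp 4]

theorem IsDoubleRoot.coeff_two_neg {a : ℕ → ℤ} {x : ℝ} (ha : a ∈ coeffSeqs)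
    (hx : x ∈ Ioo (0 : ℝ) 1) (h : IsDoubleRoot a x) (hl : 1 / 2 < x) (hu : x ≤ 0.5436)
      (h1 : a 1 = -2) :
    a 2 < 0 := by
  have h0 : a 0 = 1 := ha.1
  have hp := sub_pow_nonneg hu
  have hq := sub_pow_succ_le hl.le hu
  by_contra! hn
  rcases (show 1 ≤ a 2 ∨ a 2 = 0 by omega) with hc | h2
  · have hv : (a 2 : ℝ) ≥ 1 := by exact_mod_cast hc
    have key := h.weighted_prefix_nonneg_of_coeff_le ha hx 2 (c := 3) (d := 1)
      (by norm_num) (by push_cast; linarith)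
    norm_num [Finset.sum_range_succ, h0, h1] at key
    linarith [hp 0, hq 0, hp 1, hq 1, hp 2, hq 2, hp 3, hq 3, hp 4]
  rcases (show -1 ≤ a 3 ∨ a 3 ≤ -2 by omega) with hc | hc
  · have hv : (a 3 : ℝ) ≥ -1 := by exact_mod_cast hc
    have key := h.weighted_prefix_nonneg_of_coeff_le ha hx 3 (c := 4) (d := -1)
      (by norm_num) (by push_cast; linarith)
    norm_num [Finset.sum_range_succ, h0, h1, h2] at key
    linarith [hp 0, hq 0, hp 1, hq 1, hp 2, hq 2, hp 3, hq 3, hp 4, hq 4, hp 5]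
  · have hv : (a 3 : ℝ) ≤ -2 := by exact_mod_cast hc
    have key := h.weighted_prefix_nonneg_of_coeff_le ha hx 3 (c := -2) (d := -2)
      (by norm_num) (by push_cast; linarith)
    norm_num [Finset.sum_range_succ, h0, h1, h2] at key
    linarith [hp 0, hq 0, hp 1, hq 1, hp 2, hq 2, hp 3, hq 3, hp 4, hq 4, hp 5]

theorem IsDoubleRoot.coeff_three_eq {a : ℕ → ℤ} {x : ℝ} (ha : a ∈ coeffSeqs)
    (hx : x ∈ Ioo (0 : ℝ) 1) (h : IsDoubleRoot a x) (hl : 1 / 2 < x) (hu : x ≤ 0.5436)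
      (h1 : a 1 = -2) (h2 : a 2 = -1) :
    a 3 = 1 := by
  have h0 : a 0 = 1 := ha.1
  have hp := sub_pow_nonneg hu
  have hq := sub_pow_succ_le hl.le hu
  have hlow : ¬ a 3 ≤ 0 := by
    intro hc
    have hv : (a 3 : ℝ) ≤ 0 := by exact_mod_cast hc
    have key := h.prefix_nonneg_of_coeff_le ha hx 3 hv
    norm_num [Finset.sum_range_succ, h0, h1, h2] at key
    -- The bound in `key` is exactly the negative of this product. It vanishes at 1/2, so the strict
    -- inequality `hl` is needed.
    have h3 : 0 < (2 * x - 1) * (1 - x - x ^ 2 - x ^ 3) :=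
      mul_pos (by linarith) (by linarith [hp 0, hp 1, hp 2, hp 3, hq 0, hq 1, hq 2])
    linarith
  have hhigh : ¬ 2 ≤ a 3 := by
    intro hc
    have hv : (a 3 : ℝ) ≥ 2 := by exact_mod_cast hc
    have key := h.weighted_prefix_nonneg_of_coeff_le ha hx 3 (c := 4) (d := 2)
      (by norm_num) (by push_cast; linarith)
    norm_num [Finset.sum_range_succ, h0, h1, h2] at key
    linarith [hp 0, hq 0, hp 1, hq 1, hp 2, hq 2, hp 3, hq 3, hp 4, hq 4, hp 5]
  omega

theorem IsDoubleRoot.coeff_four_eq {a : ℕ → ℤ} {x : ℝ} (ha : a ∈ coeffSeqs)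
    (hx : x ∈ Ioo (0 : ℝ) 1) (h : IsDoubleRoot a x) (hl : 1 / 2 < x) (hu : x ≤ 0.5436)
      (h1 : a 1 = -2) (h2 : a 2 = -1) (h3 : a 3 = 1) :
    a 4 = 1 := by
  have h0 : a 0 = 1 := ha.1
  have hp := sub_pow_nonneg hu
  have hq := sub_pow_succ_le hl.le hu
  have hlow : ¬ a 4 ≤ 0 := by
    intro hc
    have hv : (a 4 : ℝ) ≤ 0 := by exact_mod_cast hc
    have key := h.weighted_prefix_nonneg_of_coeff_le ha hx 4 (c := -12) (d := 0)
      (by norm_num) (by push_cast; linarith)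
    norm_num [Finset.sum_range_succ, h0, h1, h2, h3] at key
    linarith [hp 0, hq 0, hp 1, hq 1, hp 2, hq 2, hp 3, hq 3, hp 4, hq 4, hp 5, hq 5, hp 6]
  have hhigh : ¬ 2 ≤ a 4 := by
    intro hc
    have hv : (a 4 : ℝ) ≥ 2 := by exact_mod_cast hc
    have key := h.weighted_prefix_nonneg_of_coeff_le ha hx 4 (c := 5) (d := 2)
      (by norm_num) (by push_cast; linarith)
    norm_num [Finset.sum_range_succ, h0, h1, h2, h3] at key
    linarith [hp 0, hq 0, hp 1, hq 1, hp 2, hq 2, hp 3, hq 3, hp 4, hq 4, hp 5, hq 5, hp 6]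
  omega

theorem IsDoubleRoot.coeff_five_eq {a : ℕ → ℤ} {x : ℝ} (ha : a ∈ coeffSeqs)
    (hx : x ∈ Ioo (0 : ℝ) 1) (h : IsDoubleRoot a x) (hl : 1 / 2 < x) (hu : x ≤ 0.5436)
      (h1 : a 1 = -2) (h2 : a 2 = -1) (h3 : a 3 = 1) (h4 : a 4 = 1) :
    a 5 = 1 := by
  have h0 : a 0 = 1 := ha.1
  have hp := sub_pow_nonneg hu
  have hq := sub_pow_succ_le hl.le hu
  have hlow : ¬ a 5 ≤ 0 := by
    intro hc
    have hv : (a 5 : ℝ) ≤ 0 := by exact_mod_cast hc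
    have key := h.weighted_prefix_nonneg_of_coeff_le ha hx 5 (c := -1) (d := 0)
      (by norm_num) (by push_cast; linarith)
    norm_num [Finset.sum_range_succ, h0, h1, h2, h3, h4] at key
    linarith [hp 0, hq 0, hp 1, hq 1, hp 2, hq 2, hp 3, hq 3, hp 4, hq 4, hp 5, hq 5, hp 6, hq 6,
      hp 7]
  have hhigh : ¬ 2 ≤ a 5 := by
    intro h5
    replace h5 : a 5 = 2 := le_antisymm (coeff_le_two ha 5) h5
    rcases (show a 6 ≤ -1 ∨ 0 ≤ a 6 by omega) with hc | hc
    · have hv : (a 6 : ℝ) ≤ -1 := by exact_mod_cast hc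
      have key := h.weighted_prefix_nonneg_of_coeff_le ha hx 6 (c := -1) (d := -1)
        (by norm_num) (by push_cast; linarith)
      norm_num [Finset.sum_range_succ, h0, h1, h2, h3, h4, h5] at key
      linarith [hp 0, hq 0, hp 1, hq 1, hp 2, hq 2, hp 3, hq 3, hp 4, hq 4, hp 5, hq 5, hp 6,
        hq 6, hp 7, hq 7, hp 8]
    · have hv : (a 6 : ℝ) ≥ 0 := by exact_mod_cast hc
      have key := h.weighted_prefix_nonneg_of_coeff_le ha hx 6 (c := 7) (d := 0)
        (by norm_num) (by push_cast; linarith)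
      norm_num [Finset.sum_range_succ, h0, h1, h2, h3, h4, h5] at key
      linarith [hp 0, hq 0, hp 1, hq 1, hp 2, hq 2, hp 3, hq 3, hp 4, hq 4, hp 5, hq 5, hp 6,
        hq 6, hp 7, hq 7, hp 8]
  omega

theorem IsDoubleRoot.coeff_six_eq {a : ℕ → ℤ} {x : ℝ} (ha : a ∈ coeffSeqs)
    (hx : x ∈ Ioo (0 : ℝ) 1) (h : IsDoubleRoot a x) (hl : 1 / 2 < x) (hu : x ≤ 0.5436)
      (h1 : a 1 = -2) (h2 : a 2 = -1) (h3 : a 3 = 1) (h4 : a 4 = 1) (h5 : a 5 = 1) :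
    a 6 = 2 := by
  have h0 : a 0 = 1 := ha.1
  have hp := sub_pow_nonneg hu
  have hq := sub_pow_succ_le hl.le hu
  have hlow : ¬ a 6 ≤ 1 := by
    intro hc
    have hv : (a 6 : ℝ) ≤ 1 := by exact_mod_cast hc
    -- With m = 1 - x - x² - x³, the bound from f alone is a positive multiple of m(m - x⁶). It is
    -- negative only where 0 < m < x⁶, that is, close to the root of m; farther away x f' + 6f is
    -- used. Indices 9 and 12 behave alike, with m compared to x⁹ and x¹².
    rcases le_total x 0.537 with hxt | hxt
    · have hp := sub_pow_nonneg hxt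
      have hq := sub_pow_succ_le hl.le hxt
      have key := h.weighted_prefix_nonneg_of_coeff_le ha hx 6 (c := -6) (d := 1)
        (by norm_num) (by push_cast; linarith)
      norm_num [Finset.sum_range_succ, h0, h1, h2, h3, h4, h5] at key
      linarith [hp 0, hq 0, hp 1, hq 1, hp 2, hq 2, hp 3, hq 3, hp 4, hq 4, hp 5, hq 5, hp 6,
        hq 6, hp 7, hq 7, hp 8]
    · have hq := sub_pow_succ_le hxt hu
      have key := h.prefix_nonneg_of_coeff_le ha hx 6 hv
      norm_num [Finset.sum_range_succ, h0, h1, h2, h3, h4, h5] at key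
      linarith [hp 0, hq 0, hp 1, hq 1, hp 2, hq 2, hp 3, hq 3, hp 4, hq 4, hp 5, hq 5, hp 6,
        hq 6, hp 7]
  have := coeff_le_two ha 6
  omega

theorem IsDoubleRoot.coeff_seven_eq {a : ℕ → ℤ} {x : ℝ} (ha : a ∈ coeffSeqs)
    (hx : x ∈ Ioo (0 : ℝ) 1) (h : IsDoubleRoot a x) (hl : 1 / 2 < x) (hu : x ≤ 0.5436)
      (h1 : a 1 = -2) (h2 : a 2 = -1) (h3 : a 3 = 1) (h4 : a 4 = 1) (h5 : a 5 = 1) (h6 : a 6 = 2)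
      :
    a 7 = 1 := by
  have h0 : a 0 = 1 := ha.1
  have hp := sub_pow_nonneg hu
  have hq := sub_pow_succ_le hl.le hu
  have hlow : ¬ a 7 ≤ 0 := by
    intro hc
    have hv : (a 7 : ℝ) ≤ 0 := by exact_mod_cast hc
    have key := h.weighted_prefix_nonneg_of_coeff_le ha hx 7 (c := -6) (d := 0)
      (by norm_num) (by push_cast; linarith)
    norm_num [Finset.sum_range_succ, h0, h1, h2, h3, h4, h5, h6] at key
    linarith [hp 0, hq 0, hp 1, hq 1, hp 2, hq 2, hp 3, hq 3, hp 4, hq 4, hp 5, hq 5, hp 6, hq 6,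
      hp 7, hq 7, hp 8, hq 8, hp 9]
  have hhigh : ¬ 2 ≤ a 7 := by
    intro hc
    have hv : (a 7 : ℝ) ≥ 2 := by exact_mod_cast hc
    have key := h.weighted_prefix_nonneg_of_coeff_le ha hx 7 (c := 8) (d := 2)
      (by norm_num) (by push_cast; linarith)
    norm_num [Finset.sum_range_succ, h0, h1, h2, h3, h4, h5, h6] at key
    linarith [hp 0, hq 0, hp 1, hq 1, hp 2, hq 2, hp 3, hq 3, hp 4, hq 4, hp 5, hq 5, hp 6, hq 6,
      hp 7, hq 7, hp 8, hq 8, hp 9]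
  omega

theorem IsDoubleRoot.coeff_eight_eq {a : ℕ → ℤ} {x : ℝ} (ha : a ∈ coeffSeqs)
    (hx : x ∈ Ioo (0 : ℝ) 1) (h : IsDoubleRoot a x) (hl : 1 / 2 < x) (hu : x ≤ 0.5436)
      (h1 : a 1 = -2) (h2 : a 2 = -1) (h3 : a 3 = 1) (h4 : a 4 = 1) (h5 : a 5 = 1) (h6 : a 6 = 2)
      (h7 : a 7 = 1) :
    a 8 = 1 := by
  have h0 : a 0 = 1 := ha.1
  have hp := sub_pow_nonneg hu
  have hq := sub_pow_succ_le hl.le hu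
  have hlow : ¬ a 8 ≤ 0 := by
    intro hc
    have hv : (a 8 : ℝ) ≤ 0 := by exact_mod_cast hc
    have key := h.weighted_prefix_nonneg_of_coeff_le ha hx 8 (c := -6) (d := 0)
      (by norm_num) (by push_cast; linarith)
    norm_num [Finset.sum_range_succ, h0, h1, h2, h3, h4, h5, h6, h7] at key
    linarith [hp 0, hq 0, hp 1, hq 1, hp 2, hq 2, hp 3, hq 3, hp 4, hq 4, hp 5, hq 5, hp 6, hq 6,
      hp 7, hq 7, hp 8, hq 8, hp 9, hq 9, hp 10]
  have hhigh : ¬ 2 ≤ a 8 := by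
    intro hc
    have hv : (a 8 : ℝ) ≥ 2 := by exact_mod_cast hc
    have key := h.weighted_prefix_nonneg_of_coeff_le ha hx 8 (c := 9) (d := 2)
      (by norm_num) (by push_cast; linarith)
    norm_num [Finset.sum_range_succ, h0, h1, h2, h3, h4, h5, h6, h7] at key
    linarith [hp 0, hq 0, hp 1, hq 1, hp 2, hq 2, hp 3, hq 3, hp 4, hq 4, hp 5, hq 5, hp 6, hq 6,
      hp 7, hq 7, hp 8, hq 8, hp 9, hq 9, hp 10]
  omega

theorem IsDoubleRoot.coeff_nine_eq {a : ℕ → ℤ} {x : ℝ} (ha : a ∈ coeffSeqs)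
    (hx : x ∈ Ioo (0 : ℝ) 1) (h : IsDoubleRoot a x) (hl : 1 / 2 < x) (hu : x ≤ 0.5436)
      (h1 : a 1 = -2) (h2 : a 2 = -1) (h3 : a 3 = 1) (h4 : a 4 = 1) (h5 : a 5 = 1) (h6 : a 6 = 2)
      (h7 : a 7 = 1) (h8 : a 8 = 1) :
    a 9 = 2 := by
  have h0 : a 0 = 1 := ha.1
  have hp := sub_pow_nonneg hu
  have hq := sub_pow_succ_le hl.le hu
  have hlow : ¬ a 9 ≤ 1 := by
    intro hc
    have hv : (a 9 : ℝ) ≤ 1 := by exact_mod_cast hc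
    rcases le_total x 0.5426 with hxt | hxt
    · have hp := sub_pow_nonneg hxt
      have hq := sub_pow_succ_le hl.le hxt
      have key := h.weighted_prefix_nonneg_of_coeff_le ha hx 9 (c := -6) (d := 1)
        (by norm_num) (by push_cast; linarith)
      norm_num [Finset.sum_range_succ, h0, h1, h2, h3, h4, h5, h6, h7, h8] at key
      linarith [hp 0, hq 0, hp 1, hq 1, hp 2, hq 2, hp 3, hq 3, hp 4, hq 4, hp 5, hq 5, hp 6,
        hq 6, hp 7, hq 7, hp 8, hq 8, hp 9, hq 9, hp 10, hq 10, hp 11]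
    · have hq := sub_pow_succ_le hxt hu
      have key := h.prefix_nonneg_of_coeff_le ha hx 9 hv
      norm_num [Finset.sum_range_succ, h0, h1, h2, h3, h4, h5, h6, h7, h8] at key
      linarith [hp 0, hq 0, hp 1, hq 1, hp 2, hq 2, hp 3, hq 3, hp 4, hq 4, hp 5, hq 5, hp 6,
        hq 6, hp 7, hq 7, hp 8, hq 8, hp 9, hq 9, hp 10]
  have := coeff_le_two ha 9
  omega

theorem IsDoubleRoot.coeff_ten_eq {a : ℕ → ℤ} {x : ℝ} (ha : a ∈ coeffSeqs)
    (hx : x ∈ Ioo (0 : ℝ) 1) (h : IsDoubleRoot a x) (hl : 1 / 2 < x) (hu : x ≤ 0.5436)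
      (h1 : a 1 = -2) (h2 : a 2 = -1) (h3 : a 3 = 1) (h4 : a 4 = 1) (h5 : a 5 = 1) (h6 : a 6 = 2)
      (h7 : a 7 = 1) (h8 : a 8 = 1) (h9 : a 9 = 2) :
    a 10 = 1 := by
  have h0 : a 0 = 1 := ha.1
  have hp := sub_pow_nonneg hu
  have hq := sub_pow_succ_le hl.le hu
  have hlow : ¬ a 10 ≤ 0 := by
    intro hc
    have hv : (a 10 : ℝ) ≤ 0 := by exact_mod_cast hc
    have key := h.weighted_prefix_nonneg_of_coeff_le ha hx 10 (c := -6) (d := 0)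
      (by norm_num) (by push_cast; linarith)
    norm_num [Finset.sum_range_succ, h0, h1, h2, h3, h4, h5, h6, h7, h8, h9] at key
    linarith [hp 0, hq 0, hp 1, hq 1, hp 2, hq 2, hp 3, hq 3, hp 4, hq 4, hp 5, hq 5, hp 6, hq 6,
      hp 7, hq 7, hp 8, hq 8, hp 9, hq 9, hp 10, hq 10, hp 11, hq 11, hp 12]
  have hhigh : ¬ 2 ≤ a 10 := by
    intro hc
    have hv : (a 10 : ℝ) ≥ 2 := by exact_mod_cast hc
    have key := h.weighted_prefix_nonneg_of_coeff_le ha hx 10 (c := 11) (d := 2)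
      (by norm_num) (by push_cast; linarith)
    norm_num [Finset.sum_range_succ, h0, h1, h2, h3, h4, h5, h6, h7, h8, h9] at key
    linarith [hp 0, hq 0, hp 1, hq 1, hp 2, hq 2, hp 3, hq 3, hp 4, hq 4, hp 5, hq 5, hp 6, hq 6,
      hp 7, hq 7, hp 8, hq 8, hp 9, hq 9, hp 10, hq 10, hp 11, hq 11, hp 12]
  omega

theorem IsDoubleRoot.coeff_eleven_eq {a : ℕ → ℤ} {x : ℝ} (ha : a ∈ coeffSeqs)
    (hx : x ∈ Ioo (0 : ℝ) 1) (h : IsDoubleRoot a x) (hl : 1 / 2 < x) (hu : x ≤ 0.5436)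
      (h1 : a 1 = -2) (h2 : a 2 = -1) (h3 : a 3 = 1) (h4 : a 4 = 1) (h5 : a 5 = 1) (h6 : a 6 = 2)
      (h7 : a 7 = 1) (h8 : a 8 = 1) (h9 : a 9 = 2) (h10 : a 10 = 1) :
    a 11 = 1 := by
  have h0 : a 0 = 1 := ha.1
  have hp := sub_pow_nonneg hu
  have hq := sub_pow_succ_le hl.le hu
  have hlow : ¬ a 11 ≤ 0 := by
    intro hc
    have hv : (a 11 : ℝ) ≤ 0 := by exact_mod_cast hc
    have key := h.weighted_prefix_nonneg_of_coeff_le ha hx 11 (c := -6) (d := 0)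
      (by norm_num) (by push_cast; linarith)
    norm_num [Finset.sum_range_succ, h0, h1, h2, h3, h4, h5, h6, h7, h8, h9, h10] at key
    linarith [hp 0, hq 0, hp 1, hq 1, hp 2, hq 2, hp 3, hq 3, hp 4, hq 4, hp 5, hq 5, hp 6, hq 6,
      hp 7, hq 7, hp 8, hq 8, hp 9, hq 9, hp 10, hq 10, hp 11, hq 11, hp 12, hq 12, hp 13]
  have hhigh : ¬ 2 ≤ a 11 := by
    intro hc
    have hv : (a 11 : ℝ) ≥ 2 := by exact_mod_cast hc
    have key := h.weighted_prefix_nonneg_of_coeff_le ha hx 11 (c := 12) (d := 2)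
      (by norm_num) (by push_cast; linarith)
    norm_num [Finset.sum_range_succ, h0, h1, h2, h3, h4, h5, h6, h7, h8, h9, h10] at key
    linarith [hp 0, hq 0, hp 1, hq 1, hp 2, hq 2, hp 3, hq 3, hp 4, hq 4, hp 5, hq 5, hp 6, hq 6,
      hp 7, hq 7, hp 8, hq 8, hp 9, hq 9, hp 10, hq 10, hp 11, hq 11, hp 12, hq 12, hp 13]
  omega

theorem IsDoubleRoot.coeff_two_ne_neg_one {a : ℕ → ℤ} {x : ℝ} (ha : a ∈ coeffSeqs)
    (hx : x ∈ Ioo (0 : ℝ) 1) (h : IsDoubleRoot a x) (hl : 1 / 2 < x) (hu : x ≤ 0.5436) :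
    a 2 ≠ -1 := by
  have h0 : a 0 = 1 := ha.1
  have hp := sub_pow_nonneg hu
  have hq := sub_pow_succ_le hl.le hu
  intro h2
  have h1 := h.coeff_one_eq ha hx hl hu
  have h3 := h.coeff_three_eq ha hx hl hu h1 h2
  have h4 := h.coeff_four_eq ha hx hl hu h1 h2 h3
  have h5 := h.coeff_five_eq ha hx hl hu h1 h2 h3 h4
  have h6 := h.coeff_six_eq ha hx hl hu h1 h2 h3 h4 h5
  have h7 := h.coeff_seven_eq ha hx hl hu h1 h2 h3 h4 h5 h6
  have h8 := h.coeff_eight_eq ha hx hl hu h1 h2 h3 h4 h5 h6 h7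
  have h9 := h.coeff_nine_eq ha hx hl hu h1 h2 h3 h4 h5 h6 h7 h8
  have h10 := h.coeff_ten_eq ha hx hl hu h1 h2 h3 h4 h5 h6 h7 h8 h9
  have h11 := h.coeff_eleven_eq ha hx hl hu h1 h2 h3 h4 h5 h6 h7 h8 h9 h10
  have hlow : ¬ a 12 ≤ 1 := by
    intro hc
    have hv : (a 12 : ℝ) ≤ 1 := by exact_mod_cast hc
    rcases le_total x 0.5435 with hxt | hxt
    · have hp := sub_pow_nonneg hxt
      have hq := sub_pow_succ_le hl.le hxt
      have key := h.weighted_prefix_nonneg_of_coeff_le ha hx 12 (c := -6) (d := 1)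
        (by norm_num) (by push_cast; linarith)
      norm_num [Finset.sum_range_succ, h0, h1, h2, h3, h4, h5, h6, h7, h8, h9, h10, h11] at key
      linarith [hp 0, hq 0, hp 1, hq 1, hp 2, hq 2, hp 3, hq 3, hp 4, hq 4, hp 5, hq 5, hp 6,
        hq 6, hp 7, hq 7, hp 8, hq 8, hp 9, hq 9, hp 10, hq 10, hp 11, hq 11, hp 12, hq 12,
        hp 13, hq 13, hp 14]
    · have hq := sub_pow_succ_le hxt hu
      have key := h.prefix_nonneg_of_coeff_le ha hx 12 hv
      norm_num [Finset.sum_range_succ, h0, h1, h2, h3, h4, h5, h6, h7, h8, h9, h10, h11] at key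
      linarith [hp 0, hq 0, hp 1, hq 1, hp 2, hq 2, hp 3, hq 3, hp 4, hq 4, hp 5, hq 5, hp 6,
        hq 6, hp 7, hq 7, hp 8, hq 8, hp 9, hq 9, hp 10, hq 10, hp 11, hq 11, hp 12, hq 12,
        hp 13]
  have hhigh : ¬ 2 ≤ a 12 := by
    intro hc
    have hv : (a 12 : ℝ) ≥ 2 := by exact_mod_cast hc
    have key := h.weighted_prefix_nonneg_of_coeff_le ha hx 12 (c := 13) (d := 2)
      (by norm_num) (by push_cast; linarith)
    norm_num [Finset.sum_range_succ, h0, h1, h2, h3, h4, h5, h6, h7, h8, h9, h10, h11] at key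
    linarith [hp 0, hq 0, hp 1, hq 1, hp 2, hq 2, hp 3, hq 3, hp 4, hq 4, hp 5, hq 5, hp 6, hq 6,
      hp 7, hq 7, hp 8, hq 8, hp 9, hq 9, hp 10, hq 10, hp 11, hq 11, hp 12, hq 12, hp 13, hq 13,
      hp 14]
  omega

theorem IsDoubleRoot.coeff_two_eq {a : ℕ → ℤ} {x : ℝ} (ha : a ∈ coeffSeqs)
    (hx : x ∈ Ioo (0 : ℝ) 1) (h : IsDoubleRoot a x) (hl : 1 / 2 < x) (hu : x ≤ 0.5436) :
    a 2 = -2 := by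
  have h1 := h.coeff_one_eq ha hx hl hu
  have h2 := h.coeff_two_neg ha hx hl hu h1
  have h3 := h.coeff_two_ne_neg_one ha hx hl hu
  have h4 := neg_two_le_coeff ha 2
  omega

/-! ### No double zero below 1/2 -/

theorem IsDoubleRoot.one_half_le {a : ℕ → ℤ} {x : ℝ} (ha : a ∈ coeffSeqs)
    (hx : x ∈ Ioo (0 : ℝ) 1) (h : IsDoubleRoot a x) : 1 / 2 ≤ x := by
  by_contra! hlt
  have h0 : a 0 = 1 := ha.1
  -- For c between 2 and 3 the weights change sign after index 2, so 1, -2, -2, 2, 2, … maximizes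
  -- the sum. That series has a double zero at 1/2, whence the factor 1 - 2x in `h3`.
  have key := h.weighted_prefix_nonneg ha hx 3 (c := 5 / 2) (by norm_num)
  norm_num [Finset.sum_range_succ, h0] at key
  have h1 := mul_nonneg (sq_nonneg (1 - x)) (mul_nonneg hx.1.le
    (by linarith [(abs_le.1 (abs_coeff_le ha 1)).1] : (0 : ℝ) ≤ a 1 + 2))
  have h2 := mul_nonneg (sq_nonneg (1 - x)) (mul_nonneg (sq_nonneg x)
    (by linarith [(abs_le.1 (abs_coeff_le ha 2)).1] : (0 : ℝ) ≤ a 2 + 2))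
  have h3 : 0 < (1 - 2 * x) * (5 / 2 - 3 * x + 3 / 2 * x ^ 2 + x ^ 3) :=
    mul_pos (by linarith)
      (by linarith [pow_pos hx.1 2, pow_pos hx.1 3])
  linarith

/-! ### Comparison with the extremal series -/

/-- The coefficients of `1 - 2x - 2x² + 2x³ + 2x⁴ + ⋯ = (1 - 2x)² (1 + x) / (1 - x)`. -/
def extremalSeq (i : ℕ) : ℤ := if i = 0 then 1 else if i < 3 then -2 else 2

theorem extremalSeq_mem : extremalSeq ∈ coeffSeqs := by
  refine ⟨rfl, fun i hi => ?_⟩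
  unfold extremalSeq
  split_ifs <;> simp_all

theorem extremalSeq_add_three (i : ℕ) : extremalSeq (i + 3) = 2 := by
  simp [extremalSeq]

theorem hasSum_extremalSeq {x : ℝ} (hx : |x| < 1) :
    HasSum (fun i : ℕ => (extremalSeq i : ℝ) * x ^ i) ((1 - 2 * x) ^ 2 * ((1 + x) / (1 - x))) := by
  have hx1 : 1 - x ≠ 0 := (sub_pos.2 (abs_lt.1 hx).2).ne'
  have e : (1 - 2 * x) ^ 2 * ((1 + x) / (1 - x))
      - ∑ i ∈ Finset.range 3, (extremalSeq i : ℝ) * x ^ i = 2 * x ^ 3 * (1 - x)⁻¹ := by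
    norm_num [Finset.sum_range_succ, extremalSeq]
    field_simp
    ring
  rw [← hasSum_nat_add_iff' 3, e]
  refine ((hasSum_geometric_of_abs_lt_one hx).mul_left (2 * x ^ 3)).congr_fun fun i => ?_
  rw [extremalSeq_add_three]
  push_cast; ring

theorem hasSum_index_mul_extremalSeq {x : ℝ} (hx : |x| < 1) :
    HasSum (fun i : ℕ => (i : ℝ) * extremalSeq i * x ^ i)
      (2 * x ^ 3 * (3 / (1 - x) + x / (1 - x) ^ 2) - 2 * x - 4 * x ^ 2) := by
  have e : 2 * x ^ 3 * (3 / (1 - x) + x / (1 - x) ^ 2) - 2 * x - 4 * x ^ 2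
      - ∑ i ∈ Finset.range 3, (i : ℝ) * extremalSeq i * x ^ i
      = 2 * x ^ 3 * (((3 : ℕ) - 0) / (1 - x) + x / (1 - x) ^ 2) := by
    norm_num [Finset.sum_range_succ, extremalSeq]
    ring
  rw [← hasSum_nat_add_iff' 3, e]
  refine (hasSum_affine_mul_pow hx 3 0).congr_fun fun i => ?_
  rw [extremalSeq_add_three]
  push_cast; ring

theorem add_three_sq_mul_pow_le {N : ℕ} (hN : 20 ≤ N) :
    ((N : ℝ) + 3) ^ 2 * 0.5436 ^ N ≤ 1 := by
  induction N, hN using Nat.le_induction with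
  | base => norm_num
  | succ n hn ih =>
    have hn' : (20 : ℝ) ≤ n := by exact_mod_cast hn
    have hp : (0 : ℝ) < 0.5436 ^ n := by positivity
    refine le_trans ?_ ih
    rw [pow_succ (0.5436 : ℝ), mul_comm ((0.5436 : ℝ) ^ n), ← mul_assoc]
    refine mul_le_mul_of_nonneg_right ?_ hp.le
    push_cast
    norm_num
    nlinarith

/-- Coefficients in `[0, 4]` from `N` on, the `N`-th at least `1`: the average index is less
than `N + 3`. -/
theorem index_sum_lt {b : ℕ → ℝ} {N : ℕ} {x F G : ℝ} (hx0 : 0 < x) (hx : x ≤ 0.5436)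
    (hb0 : ∀ i, 0 ≤ b i) (hb4 : ∀ i, b i ≤ 4) (hN : 1 ≤ b N) (hlt : ∀ i < N, b i = 0)
    (hF : HasSum (fun i => b i * x ^ i) F) (hG : HasSum (fun i : ℕ => (i : ℝ) * b i * x ^ i) G) :
    G < (N + 3) * F := by
  norm_num at hx
  have hx1 : |x| < 1 := by rw [abs_of_pos hx0]; linarith
  have hS := hG.sub (hF.mul_left ((N : ℝ) + 3))
  have h1 := (hasSum_nat_add_iff' (N + 4)).2 hS
  have h2 := hasSum_le (fun i => ?_) h1
    ((hasSum_affine_mul_pow hx1 (N + 4) (N + 3)).mul_left 2)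
  -- With weights i - (N + 3), index N contributes at most -3x^N, the next two at most 0, and N + 3
  -- nothing. The remaining tail is at most 4x^(N+4)/(1 - x)², which is less than 3x^N.
  · have h3 : ∑ i ∈ Finset.range (N + 4), ((i : ℝ) * b i * x ^ i - (N + 3) * (b i * x ^ i))
        ≤ -3 * x ^ N := by
      rw [Finset.sum_range_succ, Finset.sum_range_succ, Finset.sum_range_succ,
        Finset.sum_range_succ, Finset.sum_eq_zero fun i hi => by
          rw [hlt i (Finset.mem_range.1 hi)]; ring]
      push_cast
      have e0 := mul_le_mul_of_nonneg_right hN (pow_nonneg hx0.le N)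
      have e1 := mul_nonneg (hb0 (N + 1)) (pow_nonneg hx0.le (N + 1))
      have e2 := mul_nonneg (hb0 (N + 2)) (pow_nonneg hx0.le (N + 2))
      linarith
    have h4 : (2 : ℝ) * (2 * x ^ (N + 4) * (((N + 4 : ℕ) - (N + 3 : ℝ)) / (1 - x)
        + x / (1 - x) ^ 2)) = x ^ N * (4 * x ^ 4 / (1 - x) ^ 2) := by
      have : 1 - x ≠ 0 := by linarith
      push_cast
      field_simp
      ring
    have h5 : 4 * x ^ 4 / (1 - x) ^ 2 < 3 := by
      rw [div_lt_iff₀ (by nlinarith)]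
      nlinarith [pow_le_pow_left₀ hx0.le hx 4]
    have h6 := mul_lt_mul_of_pos_left h5 (pow_pos hx0 N)
    linarith
  · have hi : (0 : ℝ) ≤ i := i.cast_nonneg
    have h7 : 0 ≤ ((i : ℝ) + 1) * x ^ (i + (N + 4)) := by positivity
    have h8 := mul_le_mul_of_nonneg_left (hb4 (i + (N + 4))) h7
    push_cast
    linarith

theorem IsDoubleRoot.false_of_lt {a : ℕ → ℤ} {x : ℝ} (ha : a ∈ coeffSeqs)
    (hx : x ∈ Ioo (0 : ℝ) 1) (h : IsDoubleRoot a x) (hl : 1 / 2 < x) (hu : x ≤ 0.5436) : False := by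
  have h1 := h.coeff_one_eq ha hx hl hu
  have h2 := h.coeff_two_eq ha hx hl hu
  have hx1 : |x| < 1 := by rw [abs_of_pos hx.1]; exact hx.2
  have hx2 : 0 < 1 - x := sub_pos.2 hx.2
  have hy : 0 < 2 * x - 1 := by linarith
  -- From index 3 on `extremalSeq` takes the largest admissible value, and before that it agrees
  -- with `a`; hence `b` is nonnegative.
  set b : ℕ → ℤ := fun i => extremalSeq i - a i with hb
  have hb3 : ∀ i, b (i + 3) = 2 - a (i + 3) := fun i => by
    simp only [hb, extremalSeq_add_three]
  have hbs : ∀ i, 0 ≤ b i ∧ b i ≤ 4 := by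
    intro i
    match i with
    | 0 => simp [hb, ha.1, extremalSeq]
    | 1 => simp [hb, h1, extremalSeq]
    | 2 => simp [hb, h2, extremalSeq]
    | i + 3 =>
      have := coeff_le_two ha (i + 3)
      have := neg_two_le_coeff ha (i + 3)
      rw [hb3]
      omega
  have hF := (hasSum_extremalSeq hx1).sub h.1
  have hG := (hasSum_index_mul_extremalSeq hx1).sub h.2
  rw [sub_zero] at hF hG
  replace hF := hF.congr_fun (g := fun i => (b i : ℝ) * x ^ i) fun i => by
    simp only [hb]; push_cast; ring
  replace hG := hG.congr_fun (g := fun i : ℕ => (i : ℝ) * b i * x ^ i) fun i => by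
    simp only [hb]; push_cast; ring
  set F := (1 - 2 * x) ^ 2 * ((1 + x) / (1 - x)) with hFdef
  set G := 2 * x ^ 3 * (3 / (1 - x) + x / (1 - x) ^ 2) - 2 * x - 4 * x ^ 2 with hGdef
  have hF0 : 0 < F := by
    have : (1 - 2 * x) ^ 2 = (2 * x - 1) ^ 2 := by ring
    rw [hFdef, this]
    have := hx.1
    positivity
  have hex : ∃ i, b i ≠ 0 := by
    by_contra! hz
    simp only [hz, Int.cast_zero, zero_mul] at hF
    exact hF0.ne' (hF.unique hasSum_zero)
  classical
  set N := Nat.find hex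
  have hlt : ∀ i < N, (b i : ℝ) = 0 := fun i hi => by
    exact_mod_cast not_not.1 (Nat.find_min hex hi)
  have hN : 1 ≤ b N := by
    have h3 : b N ≠ 0 := Nat.find_spec hex
    have h4 : 0 ≤ b N := (hbs N).1
    omega
  have hGF : G < (N + 3) * F := index_sum_lt hx.1 hu (fun i => by exact_mod_cast (hbs i).1)
    (fun i => by exact_mod_cast (hbs i).2) (by exact_mod_cast hN) hlt hF hG
  have hFle : F ≤ 4 * x ^ N * (1 - x)⁻¹ := by
    have e1 := (hasSum_nat_add_iff' N).2 hF
    rw [Finset.sum_eq_zero fun i hi => by rw [hlt i (Finset.mem_range.1 hi), zero_mul],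
      sub_zero] at e1
    refine hasSum_le (fun i => ?_) e1 ((hasSum_geometric_of_abs_lt_one hx1).mul_left (4 * x ^ N))
    rw [show 4 * x ^ N * x ^ i = 4 * x ^ (i + N) by ring]
    exact mul_le_mul_of_nonneg_right (by exact_mod_cast (hbs (i + N)).2) (pow_nonneg hx.1.le _)
  -- The factor (1 - 2x)² alone contributes 4x/(2x - 1) > 2/(2x - 1) to G/F; the factor (1 + x)/(1 -
  -- x) only adds to it.
  have hGge : 2 * F ≤ (2 * x - 1) * G := by
    have e : (2 * x - 1) * G - 2 * F
        = (2 * x - 1) ^ 3 * (2 * (1 - x ^ 2) + 2 * x) / (1 - x) ^ 2 := by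
      rw [hGdef, hFdef]
      field_simp
      ring
    have : 0 ≤ (2 * x - 1) ^ 3 * (2 * (1 - x ^ 2) + 2 * x) / (1 - x) ^ 2 := by
      have := hx.1
      have : 0 ≤ 2 * (1 - x ^ 2) + 2 * x := by nlinarith
      positivity
    linarith
  have hN1 : 2 < (2 * x - 1) * (N + 3) := by
    by_contra! hle
    have := mul_lt_mul_of_pos_left hGF hy
    nlinarith
  -- Here 2x - 1 ≤ 0.0872 and 2/0.0872 > 22, so N + 3 ≥ 23.
  have hN20 : 20 ≤ N := by
    by_contra! hlt
    have : (N : ℝ) ≤ 19 := by exact_mod_cast Nat.lt_succ_iff.1 hlt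
    norm_num at hu
    nlinarith
  have hpow : x ^ N ≤ 0.5436 ^ N := pow_le_pow_left₀ hx.1.le hu N
  have hq : (2 * x - 1) ^ 2 * (1 + x) ≤ 4 * x ^ N := by
    have := mul_le_mul_of_nonneg_right hFle hx2.le
    rw [hFdef] at this
    field_simp at this
    linarith
  have hfin := add_three_sq_mul_pow_le hN20
  have hsq : 4 < ((2 * x - 1) * (N + 3)) ^ 2 := by nlinarith
  have e1 : ((N : ℝ) + 3) ^ 2 * x ^ N ≤ 1 :=
    (mul_le_mul_of_nonneg_left hpow (sq_nonneg _)).trans hfin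
  have e2 := mul_le_mul_of_nonneg_left hq (sq_nonneg ((N : ℝ) + 3))
  have e3 := mul_lt_mul_of_pos_right hsq (by linarith : 0 < 1 + x)
  nlinarith

/-! ### Two explicit double zeros -/

theorem mem_doubleZeroSet_of_eq_sq_mul {a : ℕ → ℤ} (ha : a ∈ coeffSeqs) {x : ℝ}
    (hx : x ∈ Ioo (0 : ℝ) 1) {m q : ℝ → ℝ} (hm : DifferentiableAt ℝ m x)
    (hq : DifferentiableAt ℝ q x) (hmx : m x = 0)
    (h : ∀ y : ℝ, |y| < 1 → HasSum (fun i : ℕ => (a i : ℝ) * y ^ i) (m y ^ 2 * q y)) :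
    x ∈ doubleZeroSet := by
  have hx1 : |x| < 1 := by rw [abs_of_pos hx.1]; exact hx.2
  refine ⟨hx, a, ha, ?_, ?_⟩
  · rw [seriesFun, (h x hx1).tsum_eq, hmx]
    ring
  · have hd := (hm.hasDerivAt.pow 2).mul hq.hasDerivAt
    have hd' : HasDerivAt (fun y => m y ^ 2 * q y) 0 x :=
      hd.congr_deriv (by simp [hmx])
    refine hd'.congr_of_eventuallyEq ?_
    filter_upwards [(isOpen_lt continuous_abs continuous_const).mem_nhds hx1] with y hy
    exact (h y hy).tsum_eq

theorem one_half_mem_doubleZeroSet : (1 / 2 : ℝ) ∈ doubleZeroSet := by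
  refine mem_doubleZeroSet_of_eq_sq_mul extremalSeq_mem (by norm_num) (m := fun y => 1 - 2 * y)
    (q := fun y => (1 + y) / (1 - y)) (by fun_prop) ?_ (by norm_num)
    fun y hy => hasSum_extremalSeq hy
  exact DifferentiableAt.div (by fun_prop) (by fun_prop) (by norm_num)

/-- The coefficients of `(1 - x - x² - x³)² / (1 - x³)`. -/
def tribonacciSeq (i : ℕ) : ℤ :=
  if i = 0 then 1 else if i = 1 then -2 else if i = 2 then -1 else if i = 3 then 1
  else if i % 3 = 0 then 2 else 1

theorem tribonacciSeq_mem : tribonacciSeq ∈ coeffSeqs := by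
  refine ⟨rfl, fun i hi => ?_⟩
  unfold tribonacciSeq
  split_ifs <;> simp_all

theorem tribonacciSeq_add_seven (i : ℕ) : tribonacciSeq (i + 7) = tribonacciSeq (i + 4) := by
  have h : (i + 7) % 3 = (i + 4) % 3 := by omega
  simp [tribonacciSeq, h]

theorem hasSum_tribonacciSeq {x : ℝ} (hx : |x| < 1) :
    HasSum (fun i : ℕ => (tribonacciSeq i : ℝ) * x ^ i)
      ((1 - x - x ^ 2 - x ^ 3) ^ 2 * (1 / (1 - x ^ 3))) := by
  have hx3 : 1 - x ^ 3 ≠ 0 := by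
    have h1 : |x ^ 3| < 1 := by
      rw [abs_pow]
      exact pow_lt_one₀ (abs_nonneg x) hx (by norm_num)
    exact (sub_pos.2 (abs_lt.1 h1).2).ne'
  obtain ⟨S, hS⟩ := summable_coeff tribonacciSeq_mem hx
  have h4 := ((hasSum_nat_add_iff' 4).2 hS).mul_left (x ^ 3)
  have h7 := (hasSum_nat_add_iff' 7).2 hS
  -- The coefficients have period 3 from index 4 on, so the tail from 7 is x³ times the tail from 4.
  -- This is a linear equation for the sum S.
  have heq := h7.unique (h4.congr_fun fun i => by rw [tribonacciSeq_add_seven]; ring)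
  norm_num [Finset.sum_range_succ, tribonacciSeq] at heq
  convert hS using 1
  field_simp
  linarith

theorem exists_tribonacci_root :
    ∃ x ∈ Ioo (0.5436 : ℝ) 0.5438, 1 - x - x ^ 2 - x ^ 3 = 0 := by
  have h := intermediate_value_Ioo' (a := (0.5436 : ℝ)) (b := 0.5438) (by norm_num)
    (f := fun x : ℝ => 1 - x - x ^ 2 - x ^ 3) (by fun_prop)
  obtain ⟨x, hx, h0⟩ := h (show (0 : ℝ) ∈ _ by constructor <;> norm_num)
  exact ⟨x, hx, h0⟩

theorem exists_mem_doubleZeroSet : ∃ x ∈ Ioo (0.5436 : ℝ) 0.5438, x ∈ doubleZeroSet := by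
  obtain ⟨x, hx, h0⟩ := exists_tribonacci_root
  have h1 : 0 < x := by norm_num at hx; linarith
  have h2 : x < 1 := by norm_num at hx; linarith
  refine ⟨x, hx, mem_doubleZeroSet_of_eq_sq_mul tribonacciSeq_mem ⟨h1, h2⟩
    (m := fun y => 1 - y - y ^ 2 - y ^ 3) (q := fun y => 1 / (1 - y ^ 3)) (by fun_prop) ?_ h0
    fun y hy => hasSum_tribonacciSeq hy⟩
  have : 1 - x ^ 3 ≠ 0 := (sub_pos.2 (pow_lt_one₀ h1.le h2 (by norm_num))).ne'
  exact DifferentiableAt.div (by fun_prop) (by fun_prop) this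

theorem eq_one_half_or_lt {x : ℝ} (hx : x ∈ doubleZeroSet) : x = 1 / 2 ∨ 0.5436 < x := by
  obtain ⟨a, ha, h⟩ := (mem_doubleZeroSet_iff hx.1).1 hx
  rcases (h.one_half_le ha hx.1).eq_or_lt with h1 | h1
  · exact Or.inl h1.symm
  · exact Or.inr (not_le.1 fun hu => h.false_of_lt ha hx.1 h1 hu)

/-! ### Compactness and the minimum -/

theorem isCompact_coeffSeqs : IsCompact coeffSeqs := by
  have h : coeffSeqs = Set.pi univ fun i : ℕ =>
      if i = 0 then ({1} : Set ℤ) else {0, -1, 1, -2, 2} := by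
    ext a
    simp only [coeffSeqs, mem_ofPred_eq, Set.mem_pi, mem_univ, true_implies]
    constructor
    · rintro ⟨h0, h1⟩ i
      split_ifs with hi
      · rw [hi, h0]; rfl
      · exact h1 i (by omega)
    · intro h
      refine ⟨by simpa using h 0, fun i hi => ?_⟩
      have := h i
      rwa [if_neg (by omega)] at this
  rw [h]
  refine isCompact_univ_pi fun i => Set.Finite.isCompact ?_
  split_ifs
  · exact finite_singleton _
  · exact Set.toFinite _

/-- Weighted power series depend continuously on the coefficients and the variable. -/
theorem continuousOn_tsum_coeff {w : ℕ → ℝ} (hw0 : ∀ i, 0 ≤ w i) {r : ℝ}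
    (hw : Summable fun i : ℕ => w i * r ^ i) :
    ContinuousOn (fun p : (ℕ → ℤ) × ℝ => ∑' i : ℕ, w i * p.1 i * p.2 ^ i)
      (coeffSeqs ×ˢ Icc 0 r) := by
  refine continuousOn_tsum (u := fun i => 2 * (w i * r ^ i)) (fun i => ?_) (hw.mul_left 2) ?_
  · have : Continuous fun p : (ℕ → ℤ) × ℝ => ((p.1 i : ℤ) : ℝ) :=
      continuous_of_discreteTopology.comp ((continuous_apply i).comp continuous_fst)
    exact ((continuous_const.mul this).mul (continuous_snd.pow i)).continuousOn
  · rintro i p ⟨hp1, hp2⟩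
    rw [Real.norm_eq_abs, abs_mul, abs_mul, abs_pow, abs_of_nonneg (hw0 i), abs_of_nonneg hp2.1]
    have h1 := mul_le_mul_of_nonneg_left (abs_coeff_le hp1 i) (hw0 i)
    have h2 := pow_le_pow_left₀ hp2.1 hp2.2 i
    calc _ ≤ w i * 2 * r ^ i := mul_le_mul h1 h2 (pow_nonneg hp2.1 i)
          (mul_nonneg (hw0 i) zero_le_two)
      _ = _ := by ring

/-- This is the projection to x of the pairs (a, x) with f = x f' = 0, a closed subset of the
compact product of `coeffSeqs` and [l, r]. -/
theorem isCompact_doubleZeroSet_inter_Icc {l r : ℝ} (hl : 0 < l) (hr : r < 1) :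
    IsCompact (doubleZeroSet ∩ Icc l r) := by
  rcases lt_or_ge r l with hlr | hlr
  · simp [Icc_eq_empty hlr.not_ge]
  have hr1 : |r| < 1 := by rwa [abs_of_pos (hl.trans_le hlr)]
  set K : Set ((ℕ → ℤ) × ℝ) := coeffSeqs ×ˢ Icc l r
  have hK : IsCompact K := isCompact_coeffSeqs.prod isCompact_Icc
  have hsub : K ⊆ coeffSeqs ×ˢ Icc 0 r := prod_mono_right (Icc_subset_Icc_left hl.le)
  have h0 := (continuousOn_tsum_coeff (w := fun _ => 1) (fun _ => zero_le_one)
    (by simpa using (hasSum_geometric_of_abs_lt_one hr1).summable)).mono hsub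
  have h1 := (continuousOn_tsum_coeff (w := fun i => (i : ℝ)) (fun i => i.cast_nonneg)
    (hasSum_index_mul_pow hr1).summable).mono hsub
  have hC := (h0.prodMk h1).preimage_isClosed_of_isClosed hK.isClosed
    (isClosed_singleton (x := ((0 : ℝ), (0 : ℝ))))
  have him := ((hK.of_isClosed_subset hC inter_subset_left).image continuous_snd)
  convert him using 1
  ext x
  constructor
  · rintro ⟨hx, hxI⟩
    obtain ⟨a, ha, h⟩ := (mem_doubleZeroSet_iff hx.1).1 hx
    refine ⟨(a, x), ⟨⟨ha, hxI⟩, ?_⟩, rfl⟩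
    simp only [one_mul, mem_preimage, mem_singleton_iff, Prod.mk.injEq]
    exact ⟨h.1.tsum_eq, h.2.tsum_eq⟩
  · rintro ⟨⟨a, y⟩, ⟨⟨ha, hy⟩, h⟩, rfl⟩
    simp only [one_mul, mem_preimage, mem_singleton_iff, Prod.mk.injEq] at h
    have hy1 : |y| < 1 := by
      rw [abs_of_pos (hl.trans_le hy.1)]; exact hy.2.trans_lt hr
    exact ⟨(mem_doubleZeroSet_iff ⟨hl.trans_le hy.1, hy.2.trans_lt hr⟩).2 ⟨a, ha,
      (summable_coeff ha hy1).hasSum_iff.2 h.1,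
      (summable_index_mul_coeff ha hy1).hasSum_iff.2 h.2⟩, hy⟩

theorem proposition6p3 :
    (1 / 2 : ℝ) ∈ doubleZeroSet ∧
    ¬ AccPt (1 / 2 : ℝ) (𝓟 doubleZeroSet) ∧
    ∃ m : ℝ, IsLeast (doubleZeroSet \ {1 / 2}) m ∧ m ∈ Ioo (0.5436 : ℝ) 0.5438 := by
  refine ⟨one_half_mem_doubleZeroSet, ?_, ?_⟩
  · rw [accPt_iff_nhds]
    intro h
    obtain ⟨y, ⟨hy1, hy2⟩, hne⟩ := h (Iio 0.5436) (Iio_mem_nhds (by norm_num))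
    rcases eq_one_half_or_lt hy2 with h1 | h1
    · exact hne h1
    · exact lt_asymm h1 hy1
  · obtain ⟨x, hx, hxD⟩ := exists_mem_doubleZeroSet
    -- The left end 0.5436 cuts off the point 1/2 and loses no other double zero; the right end is a
    -- known one, so the set is nonempty.
    obtain ⟨m, ⟨hmD, hmI⟩, hmin⟩ := (isCompact_doubleZeroSet_inter_Icc (l := 0.5436) (r := x)
      (by norm_num) hxD.1.2).exists_isLeast ⟨x, hxD, hx.1.le, le_rfl⟩
    have hm : 0.5436 < m := (eq_one_half_or_lt hmD).resolve_left fun h => by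
      have := hmI.1; rw [h] at this; norm_num at this
    refine ⟨m, ⟨⟨hmD, fun h => ?_⟩, fun y hy => ?_⟩, hm, hmI.2.trans_lt hx.2⟩
    · rw [mem_singleton_iff.1 h] at hm; norm_num at hm
    · have hy1 := (eq_one_half_or_lt hy.1).resolve_left hy.2
      rcases le_total y x with hyx | hyx
      · exact hmin ⟨hy.1, hy1.le, hyx⟩
      · exact hmI.2.trans hyx
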